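/- For integers $s_1\ge 2$ and $s_2,\dots,s_d\ge 1$ let $$\zeta(s_1,\dots,s_d)=\sum_{k_1>\cdots>k_d>0}\frac1{k_1^{s_1}\cdots k_d^{s_d}},$$ and put $\zeta(s_1,\dots,s_d)=0$ when these conditions on the indices fail. For a function $f$ of two or three variables write $$\bigoplus_{\mathcal C(x,y)}f(x,y)=f(x,y)+f(y,x),\qquad \bigoplus_{\mathcal C(x,y,z)}f(x,y,z)=f(x,y,z)+f(y,z,x)+f(z,x,y),$$ where variables that are not listed stay fixed. Let $0^0=1$, let $\delta_{n,m}$ be the Kronecker delta, let $n\ge 2$ be an integer, let $a,b,c$ be real numbers and let $\sigma=a+b$. Put $$\begin{aligned} D_{j,k}={}&\bigoplus_{\mathcal C(a,b,c)}\bigoplus_{\mathcal C(j,k)}\Big(\frac{a^j(bc^k-cb^k)}{c-b}-a^jb^{k-1}c-a^jbc^{k-1}\Big)\\ &-\bigoplus_{\mathcal C(a,b)}\Big(\frac{\sigma^{j-1}a(bc^k-cb^k)}{c-b}-a^jbc^{k-1}-\sigma^{j-1}b^{k-1}ac+\frac{ab^kc^j-\sigma^{j-1}acb^k}{c-b-a}-\sigma^{j-2}b^kac\\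 &\qquad\qquad+\bigoplus_{\mathcal C(j,k)}\Big(acb^{j+k-2}-\frac{b^{k-1}a(bc^j-cb^j)}{c-b}\Big)\Big),\\ S_n={}&\bigoplus_{\mathcal C(a,b)}\Big(ac\sigma^{n-2}-a^{n-1}c-c^{n-1}a-2ab^{n-2}c+\frac{acb^{n-1}-bca^{n-1}}{2(b-a)}\Big),\\ Z_n={}&\bigoplus_{\mathcal C(b,c)}\Big(\frac{b^2(a^2c^{n-1}-a^nc)}{c(c-b)(c-a)}+a^{n-1}b\Big). \end{aligned}$$ For $j\ge 2$, $k\ge 1$, $j+k=n$, the functions $D_{j,k}$, $S_n$, $Z_n$ of $(a,b,c)$, defined by these formulas where no denominator vanishes (that is, where $b,c\ne0$, the numbers $a,b,c$ are distinct and $c\ne a+b$), have a limit at every point of $\mathbb R^3$. Denote by the same letters their continuous extensions to $\mathbb R^3$. Then for all real $a,b,c$ and all $n\ge 2$ $$\begin{aligned} &\sum_{\substack{j\ge 2,\,k,l\ge 1\\ j+k+l=n}}\bigoplus_{\mathcal C(a,b)}\Big(a\sigma^{j-1}(b^kc^l+b^lc^k)+a\sigma^{k-1}b^lc^j-\bigoplus_{\mathcal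 C(j,k,l)}\big(a^{j+k-1}bc^l+a^jb^kc^l\big)\Big)\zeta(j,k,l)\\ &-\sum_{\substack{j\ge 2,\,k\ge 1\\ j+k=n-1}}\bigoplus_{\mathcal C(a,b)}\Big(a\sigma^{j-1}b^kc-a^{j+k-1}bc-a^jb^kc\Big)\zeta(j,k,1)\\ &-\sum_{\substack{j\ge 2,\,k\ge 1\\ j+k=n-1}}\bigoplus_{\mathcal C(a,b)}\Big(a\sigma^{j-1}b^kc-a^{j+k-1}bc-a^kbc^j-a^kcb^j\Big)\zeta(j,1,k)\\ ={}&\sum_{\substack{j\ge 2,\,k\ge 1\\ j+k=n}}D_{j,k}\,\zeta(j,k)-S_n\,\zeta(n-1,1)+Z_n\,\zeta(n)+bca^{n-2}\zeta(n)+abc^{n-2}\zeta(n-2,2)\\ &+\bigoplus_{\mathcal C(a,b,c)}a^{n-2}bc\;\zeta(2,n-2)-\delta_{n,2}(ab+ac+bc)\zeta(2)-\delta_{n,3}\,abc\,\big(\zeta(2,1)+\zeta(3)\big). \end{aligned}$$ Here the cyclic sums $\bigoplus$ act on the coefficients only, not on the arguments of $\zeta$. -/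

import Mathlib

open Filter Topology

noncomputable section

namespace WeightedSum

/-- An index `(s₁, …, s_d)` is admissible if `s₁ ≥ 2` and `s₂, …, s_d ≥ 1`; these are the
indices for which the multiple zeta series converges. -/
def Admissible {d : ℕ} (s : Fin d → ℕ) : Prop :=
  ∀ i : Fin d, 1 ≤ s i ∧ (i.val = 0 → 2 ≤ s i)

open Classical in
/-- The multiple zeta value
`ζ(s₁, …, s_d) = ∑_{k₁ > ⋯ > k_d > 0} 1 / (k₁ ^ s₁ ⋯ k_d ^ s_d)`,
with the convention that it is `0` at the indices that are not admissible. -/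
def mzv {d : ℕ} (s : Fin d → ℕ) : ℝ :=
  if Admissible s then
    ∑' k : {k : Fin d → ℕ // StrictAnti k ∧ ∀ i, 0 < k i}, ∏ i, 1 / (k.1 i : ℝ) ^ s i
  else 0

/-- The cyclic sum `f(x, y) + f(y, x)` over two variables. -/
def cyc₂ {α : Type} (f : α → α → ℝ) (x y : α) : ℝ :=
  f x y + f y x

/-- The cyclic sum `f(x, y, z) + f(y, z, x) + f(z, x, y)` over three variables. -/
def cyc₃ {α : Type} (f : α → α → α → ℝ) (x y z : α) : ℝ :=
  f x y z + f y z x + f z x y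

/-- The pairs `(j, k)` with `j ≥ 2`, `k ≥ 1` and `j + k = m`. -/
def pairs (m : ℕ) : Finset (ℕ × ℕ) :=
  (Finset.Icc 2 m ×ˢ Finset.Icc 1 m).filter fun p => p.1 + p.2 = m

/-- The triples `(j, k, l)` with `j ≥ 2`, `k, l ≥ 1` and `j + k + l = m`. -/
def triples (m : ℕ) : Finset (ℕ × ℕ × ℕ) :=
  (Finset.Icc 2 m ×ˢ Finset.Icc 1 m ×ˢ Finset.Icc 1 m).filter
    fun p => p.1 + p.2.1 + p.2.2 = m

/-- The coefficient of `ζ(j, k)` in the sum over `j + k = n`, as a quotient; it is used for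
`j ≥ 2` and `k ≥ 1` only. -/
def doubleCoeff (a b c : ℝ) (j k : ℕ) : ℝ :=
  cyc₃ (fun a b c => cyc₂ (fun j k =>
      a ^ j * (b * c ^ k - c * b ^ k) / (c - b)
        - a ^ j * b ^ (k - 1) * c - a ^ j * b * c ^ (k - 1)) j k) a b c
  - cyc₂ (fun a b =>
      (a + b) ^ (j - 1) * a * (b * c ^ k - c * b ^ k) / (c - b)
        - a ^ j * b * c ^ (k - 1)
        - (a + b) ^ (j - 1) * b ^ (k - 1) * a * c
        + (a * b ^ k * c ^ j - (a + b) ^ (j - 1) * a * c * b ^ k) / (c - b - a)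
        - (a + b) ^ (j - 2) * b ^ k * a * c
        + cyc₂ (fun j k => a * c * b ^ (j + k - 2)
            - b ^ (k - 1) * a * (b * c ^ j - c * b ^ j) / (c - b)) j k) a b

/-- The coefficient of `-ζ(n - 1, 1)`, as a quotient. -/
def subleadingCoeff (n : ℕ) (a b c : ℝ) : ℝ :=
  cyc₂ (fun a b =>
      a * c * (a + b) ^ (n - 2) - a ^ (n - 1) * c - c ^ (n - 1) * a - 2 * a * b ^ (n - 2) * c
        + (a * c * b ^ (n - 1) - b * c * a ^ (n - 1)) / (2 * (b - a))) a b

/-- The first part of the coefficient of `ζ(n)`, as a quotient. -/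
def singleCoeff (n : ℕ) (a b c : ℝ) : ℝ :=
  cyc₂ (fun b c =>
      b ^ 2 * (a ^ 2 * c ^ (n - 1) - a ^ n * c) / (c * (c - b) * (c - a)) + a ^ (n - 1) * b) b c

/-- The parameters `(a, b, c)` at which no denominator vanishes. -/
def generic : Set (ℝ × ℝ × ℝ) :=
  {p | p.2.1 ≠ 0 ∧ p.2.2 ≠ 0 ∧ p.1 ≠ p.2.1 ∧ p.1 ≠ p.2.2 ∧ p.2.1 ≠ p.2.2 ∧
    p.2.2 ≠ p.1 + p.2.1}

end WeightedSum

end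

/-! The theorem comes from a weighted sum formula in depth two by one more multiplication with
single zeta values. In depth two, `∑ a^i b^(m-i) ζ(i) ζ(m-i)` over `2 ≤ i ≤ m-2` is evaluated twice.
The stuffle product gives double zetas and `ζ(m)`, the shuffle product (partial fractions of `1/(x^i
y^(m-i))`) gives double zetas with powers of `a + b`. Comparison yields `sum_doubleWeight`.

Take this formula in weight `n - l`, multiply it by `c^l ζ(l)` and sum over `2 ≤ l ≤ n-2`. Stuffling
`ζ(j,k) ζ(l)` and `ζ(n-l) ζ(l)` gives triple, double and single zetas. The triple part is the left
side of the theorem (`triple_sum_eq`): its two subtracted sums remove the words in which an entry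
that must be at least 2 equals 1. The double and single parts (`stuffle_triple_sum`) have finite
geometric sums as coefficients.

Summing these geometric series produces the quotients `D`, `S`, `Z`. The summed formulas fail for
empty ranges, which accounts for the exceptional terms at `j = 2`, `k = 2` and small `n`. Since the
unsummed coefficients are polynomials, they provide the continuous extensions (`doublePoly_eq`,
`subleadingPoly_eq`, `singlePoly_eq`). -/

noncomputable section

namespace WeightedSum

/-! ### Truncated multiple zeta sums and their convergence. -/

/-- The multiple harmonic sum: the multiple zeta series truncated to `N ≥ k₁ > ⋯ > k_d > 0`. -/
def harmonicSum : {d : ℕ} → (Fin d → ℕ) → ℕ → ℝ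
  | 0, _, _ => 1
  | _ + 1, s, N => ∑ x ∈ Finset.range N, 1 / ((x : ℝ) + 1) ^ s 0 * harmonicSum (Fin.tail s) x

theorem harmonicSum_succ {d : ℕ} (s : Fin (d + 1) → ℕ) (N : ℕ) :
    harmonicSum s N =
      ∑ x ∈ Finset.range N, 1 / ((x : ℝ) + 1) ^ s 0 * harmonicSum (Fin.tail s) x := rfl

theorem harmonicSum_nonneg {d : ℕ} (s : Fin d → ℕ) (N : ℕ) : 0 ≤ harmonicSum s N := by
  induction d generalizing N with
  | zero => simp [harmonicSum]
  | succ d ih =>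
    rw [harmonicSum_succ]
    exact Finset.sum_nonneg fun x _ => mul_nonneg (by positivity) (ih _ _)

/-- The summation range of the multiple harmonic sum. -/
def decreasing (d N : ℕ) : Finset (Fin d → ℕ) :=
  open Classical in (Fintype.piFinset fun _ => Finset.Icc 1 N).filter StrictAnti

theorem mem_decreasing {d N : ℕ} {k : Fin d → ℕ} :
    k ∈ decreasing d N ↔ (∀ i, 1 ≤ k i ∧ k i ≤ N) ∧ StrictAnti k := by
  simp [decreasing]

theorem cons_mem_decreasing {d N x : ℕ} {k : Fin d → ℕ} :
    (Fin.cons (x + 1) k : Fin (d + 1) → ℕ) ∈ decreasing (d + 1) N ↔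
      x < N ∧ k ∈ decreasing d x := by
  simp only [mem_decreasing, Fin.forall_fin_succ, Fin.cons_zero, Fin.cons_succ]
  constructor
  · rintro ⟨⟨h0, h1⟩, h2⟩
    refine ⟨by omega, fun i => ⟨(h1 i).1, ?_⟩, fun i j hij => ?_⟩
    · have := h2 (Fin.succ_pos i)
      simp only [Fin.cons_zero, Fin.cons_succ] at this
      omega
    · simpa using h2 (Fin.succ_lt_succ_iff.2 hij)
  · rintro ⟨h0, h1, h2⟩
    refine ⟨⟨by omega, fun i => ⟨(h1 i).1, by have := (h1 i).2; omega⟩⟩, fun i j hij => ?_⟩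
    induction j using Fin.cases with
    | zero => simp at hij
    | succ j =>
      induction i using Fin.cases with
      | zero =>
        have := (h1 j).2
        simp only [Fin.cons_zero, Fin.cons_succ]
        omega
      | succ i => simpa using h2 (Fin.succ_lt_succ_iff.1 hij)

theorem sum_decreasing {d : ℕ} (s : Fin d → ℕ) (N : ℕ) :
    ∑ k ∈ decreasing d N, ∏ i, 1 / (k i : ℝ) ^ s i = harmonicSum s N := by
  induction d generalizing N with
  | zero =>
    have : decreasing 0 N = Finset.univ := by
      ext k
      simp only [mem_decreasing, Finset.mem_univ, iff_true]
      exact ⟨fun i => i.elim0, fun i => i.elim0⟩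
    simp [this, harmonicSum]
  | succ d ih =>
    rw [harmonicSum_succ]
    simp only [← ih, Finset.mul_sum]
    rw [Finset.sum_sigma']
    symm
    refine Finset.sum_bij' (fun p _ => (Fin.cons (p.1 + 1) p.2 : Fin (d + 1) → ℕ))
      (fun k _ => ⟨k 0 - 1, Fin.tail k⟩) ?_ ?_ ?_ ?_ ?_
    · rintro ⟨x, k⟩ h
      simpa [cons_mem_decreasing] using h
    · intro k h
      have h1 := ((mem_decreasing.1 h).1 0).1
      have e : (Fin.cons (k 0 - 1 + 1) (Fin.tail k) : Fin (d + 1) → ℕ) = k := by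
        rw [Nat.sub_add_cancel h1, Fin.cons_self_tail]
      rw [← e, cons_mem_decreasing] at h
      simpa using h
    · rintro ⟨x, k⟩ h
      simp
    · intro k h
      have h1 := ((mem_decreasing.1 h).1 0).1
      simp [Nat.sub_add_cancel h1]
    · rintro ⟨x, k⟩ h
      simp [Fin.prod_univ_succ, Fin.tail, mul_comm]

/-- The true growth is a power of the logarithm; a square root is easier to carry through the
induction and still leaves a convergent series after division by `k₁ ^ 2`. -/
theorem harmonicSum_le_sqrt {d : ℕ} (s : Fin d → ℕ) (hs : ∀ i, 1 ≤ s i) (N : ℕ) :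
    harmonicSum s N ≤ 3 ^ d * √((N : ℝ) + 1) := by
  induction d generalizing N with
  | zero => simp [harmonicSum]
  | succ d ih =>
    induction N with
    | zero => simp [harmonicSum]
    | succ N ihN =>
      rw [harmonicSum_succ, Finset.sum_range_succ, ← harmonicSum_succ]
      have h1 := ih (Fin.tail s) (fun i => hs _) N
      have h0 := harmonicSum_nonneg (Fin.tail s) N
      have hx : (1 : ℝ) ≤ (N : ℝ) + 1 := by linarith [(Nat.cast_nonneg N : (0 : ℝ) ≤ N)]
      have h2 : 1 / ((N : ℝ) + 1) ^ s 0 ≤ 1 / ((N : ℝ) + 1) :=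
        one_div_le_one_div_of_le (by linarith) (le_self_pow₀ hx (by have := hs 0; omega))
      have h3 : 1 / ((N : ℝ) + 1) ^ s 0 * harmonicSum (Fin.tail s) N
          ≤ 1 / ((N : ℝ) + 1) * (3 ^ d * √((N : ℝ) + 1)) := by gcongr
      -- With `u`, `v` the two roots, `v ^ 2 - u ^ 2 = 1`, so the claim is `u + v ≤ 3 * u`, that is
      -- `v ≤ 2 * u`; hence the constant 3.
      have h4 : 1 / ((N : ℝ) + 1) * √((N : ℝ) + 1) ≤
          3 * √((N : ℝ) + 1 + 1) - 3 * √((N : ℝ) + 1) := by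
        set u := √((N : ℝ) + 1) with hu
        set v := √((N : ℝ) + 1 + 1) with hv
        have hu2 : u ^ 2 = (N : ℝ) + 1 := Real.sq_sqrt (by linarith)
        have hv2 : v ^ 2 = (N : ℝ) + 1 + 1 := Real.sq_sqrt (by linarith)
        have hu1 : 1 ≤ u := Real.one_le_sqrt.2 hx
        have huv : u ≤ v := Real.sqrt_le_sqrt (by linarith)
        have hv3 : v ≤ 2 * u := by nlinarith
        rw [← hu2]
        have : 1 / u ^ 2 * u = 1 / u := by field_simp
        rw [this, div_le_iff₀ (by linarith)]
        nlinarith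
      push_cast
      calc _ ≤ 3 ^ (d + 1) * √((N : ℝ) + 1) + 3 ^ d * (1 / ((N : ℝ) + 1) * √((N : ℝ) + 1)) := by
            linarith
        _ ≤ 3 ^ (d + 1) * √((N : ℝ) + 1)
            + 3 ^ d * (3 * √((N : ℝ) + 1 + 1) - 3 * √((N : ℝ) + 1)) := by gcongr
        _ = _ := by ring

theorem harmonicSum_bounded {d : ℕ} {s : Fin (d + 1) → ℕ} (hs : Admissible s) :
    ∃ C, ∀ N, harmonicSum s N ≤ C := by
  have hsum : Summable fun x : ℕ => 3 ^ d * (1 / ((x : ℝ) + 1) ^ (3 / 2 : ℝ)) := by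
    refine Summable.mul_left _ ?_
    have := (summable_nat_add_iff 1).2
      (Real.summable_one_div_nat_rpow.2 (by norm_num : (1 : ℝ) < 3 / 2))
    simpa using this
  refine ⟨∑' x : ℕ, 3 ^ d * (1 / ((x : ℝ) + 1) ^ (3 / 2 : ℝ)), fun N => ?_⟩
  refine le_trans ?_ (hsum.sum_le_tsum (Finset.range N) fun x _ => by positivity)
  rw [harmonicSum_succ]
  refine Finset.sum_le_sum fun x _ => ?_
  have hx : (1 : ℝ) ≤ (x : ℝ) + 1 := by linarith [(Nat.cast_nonneg x : (0 : ℝ) ≤ x)]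
  have h0 := harmonicSum_nonneg (Fin.tail s) x
  have h1 := harmonicSum_le_sqrt (Fin.tail s) (fun i => (hs _).1) x
  have h2 : 1 / ((x : ℝ) + 1) ^ s 0 ≤ 1 / ((x : ℝ) + 1) ^ 2 :=
    one_div_le_one_div_of_le (by positivity) (pow_le_pow_right₀ hx ((hs 0).2 rfl))
  calc _ ≤ 1 / ((x : ℝ) + 1) ^ 2 * (3 ^ d * √((x : ℝ) + 1)) := by gcongr
    _ = _ := by
      have e : ((x : ℝ) + 1) ^ (3 / 2 : ℝ) * √((x : ℝ) + 1) = ((x : ℝ) + 1) ^ 2 := by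
        rw [Real.sqrt_eq_rpow, ← Real.rpow_add (by linarith), ← Real.rpow_natCast]
        norm_num
      rw [← e]
      field_simp

/-- The multiple harmonic sums converge to the multiple zeta value. -/
theorem tendsto_harmonicSum {d : ℕ} {s : Fin (d + 1) → ℕ} (hs : Admissible s) :
    Tendsto (harmonicSum s) atTop (𝓝 (mzv s)) := by
  classical
  let P : (Fin (d + 1) → ℕ) → Prop := fun k => StrictAnti k ∧ ∀ i, 0 < k i
  let f : {k : Fin (d + 1) → ℕ // P k} → ℝ := fun k => ∏ i, 1 / (k.1 i : ℝ) ^ s i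
  let B : ℕ → Finset {k : Fin (d + 1) → ℕ // P k} := fun N => (decreasing (d + 1) N).subtype P
  have hB : ∀ N, ∑ k ∈ B N, f k = harmonicSum s N := by
    intro N
    rw [← sum_decreasing]
    refine Finset.sum_subtype_of_mem (fun k : Fin (d + 1) → ℕ => ∏ i, 1 / (k i : ℝ) ^ s i) ?_
    intro k hk
    exact ⟨(mem_decreasing.1 hk).2, fun i => ((mem_decreasing.1 hk).1 i).1⟩
  have hmem : ∀ k : {k : Fin (d + 1) → ℕ // P k}, k ∈ B (k.1 0) := by
    intro k
    simp only [B, Finset.mem_subtype, mem_decreasing]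
    exact ⟨fun i => ⟨k.2.2 i, k.2.1.antitone (Fin.zero_le i)⟩, k.2.1⟩
  have hmono : Monotone B := by
    intro M N h k
    simp only [B, Finset.mem_subtype, mem_decreasing]
    exact fun hk => ⟨fun i => ⟨(hk.1 i).1, (hk.1 i).2.trans h⟩, hk.2⟩
  have hBt : Tendsto B atTop atTop :=
    tendsto_atTop_finset_of_monotone hmono fun k => ⟨_, hmem k⟩
  have hf0 : ∀ k, 0 ≤ f k := fun k => Finset.prod_nonneg fun i _ => by positivity
  obtain ⟨C, hC⟩ := harmonicSum_bounded hs
  have hf : Summable f := by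
    -- The boxes `B N` exhaust the index set, so every finite partial sum is dominated by some
    -- bounded harmonic sum.
    refine summable_of_sum_le hf0 (c := C) fun u => ?_
    obtain ⟨N, hN⟩ := (hBt.eventually (eventually_ge_atTop u)).exists
    exact (Finset.sum_le_sum_of_subset_of_nonneg hN fun k _ _ => hf0 k).trans
      ((hB N).trans_le (hC N))
  have hz : mzv s = ∑' k, f k := by
    rw [mzv, if_pos hs]
  rw [hz]
  exact (hf.hasSum.comp hBt).congr hB

/-! ### Stuffle products. -/

theorem harmonicSum_one (s N : ℕ) :
    harmonicSum ![s] N = ∑ x ∈ Finset.range N, 1 / ((x : ℝ) + 1) ^ s := by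
  simp [harmonicSum]

theorem harmonicSum_one_succ (s N : ℕ) :
    harmonicSum ![s] (N + 1) = harmonicSum ![s] N + 1 / ((N : ℝ) + 1) ^ s := by
  simp [harmonicSum_one, Finset.sum_range_succ]

theorem harmonicSum_cons_succ {d : ℕ} (j : ℕ) (s : Fin d → ℕ) (N : ℕ) :
    harmonicSum (Matrix.vecCons j s) (N + 1) =
      harmonicSum (Matrix.vecCons j s) N + 1 / ((N : ℝ) + 1) ^ j * harmonicSum s N := by
  rw [harmonicSum_succ, Finset.sum_range_succ, ← harmonicSum_succ]
  rfl

theorem harmonicSum_one_mul_one (j l N : ℕ) :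
    harmonicSum ![j] N * harmonicSum ![l] N =
      harmonicSum ![j, l] N + harmonicSum ![l, j] N + harmonicSum ![j + l] N := by
  induction N with
  | zero => simp [harmonicSum]
  | succ N ih =>
    simp only [harmonicSum_one_succ, harmonicSum_cons_succ _ ![_]]
    rw [pow_add, ← one_div_mul_one_div]
    linear_combination ih

/-- Raising the cutoff to `N + 1` adds `1/(N+1)^j` times a product of two depth-one sums, which the
depth-one stuffle expands. -/
theorem harmonicSum_two_mul_one (j k l N : ℕ) :
    harmonicSum ![j, k] N * harmonicSum ![l] N =
      harmonicSum ![j, k, l] N + harmonicSum ![j, l, k] N + harmonicSum ![l, j, k] N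
        + harmonicSum ![j + l, k] N + harmonicSum ![j, k + l] N := by
  induction N with
  | zero => simp [harmonicSum]
  | succ N ih =>
    simp only [harmonicSum_one_succ, harmonicSum_cons_succ _ ![_], harmonicSum_cons_succ _ ![_, _]]
    rw [pow_add, ← one_div_mul_one_div]
    linear_combination ih + 1 / ((N : ℝ) + 1) ^ j * harmonicSum_one_mul_one k l N

theorem admissible_one {s : ℕ} (hs : 2 ≤ s) : Admissible ![s] := by
  intro i
  fin_cases i
  simp
  omega

theorem admissible_two {j k : ℕ} (hj : 2 ≤ j) (hk : 1 ≤ k) : Admissible ![j, k] := by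
  intro i
  fin_cases i <;> simp <;> omega

theorem admissible_three {j k l : ℕ} (hj : 2 ≤ j) (hk : 1 ≤ k) (hl : 1 ≤ l) :
    Admissible ![j, k, l] := by
  intro i
  fin_cases i <;> simp <;> omega

theorem mzv_one_mul_one {j l : ℕ} (hj : 2 ≤ j) (hl : 2 ≤ l) :
    mzv ![j] * mzv ![l] = mzv ![j, l] + mzv ![l, j] + mzv ![j + l] := by
  refine tendsto_nhds_unique ((tendsto_harmonicSum (admissible_one hj)).mul
    (tendsto_harmonicSum (admissible_one hl))) ?_
  simp only [harmonicSum_one_mul_one]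
  exact ((tendsto_harmonicSum (admissible_two hj (by omega))).add
    (tendsto_harmonicSum (admissible_two hl (by omega)))).add
    (tendsto_harmonicSum (admissible_one (by omega)))

theorem mzv_two_mul_one {j k l : ℕ} (hj : 2 ≤ j) (hk : 1 ≤ k) (hl : 2 ≤ l) :
    mzv ![j, k] * mzv ![l] =
      mzv ![j, k, l] + mzv ![j, l, k] + mzv ![l, j, k] + mzv ![j + l, k] + mzv ![j, k + l] := by
  refine tendsto_nhds_unique ((tendsto_harmonicSum (admissible_two hj hk)).mul
    (tendsto_harmonicSum (admissible_one hl))) ?_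
  simp only [harmonicSum_two_mul_one]
  exact ((((tendsto_harmonicSum (admissible_three hj hk (by omega))).add
    (tendsto_harmonicSum (admissible_three hj (by omega) hk))).add
    (tendsto_harmonicSum (admissible_three hl (by omega) hk))).add
    (tendsto_harmonicSum (admissible_two (by omega) hk))).add
    (tendsto_harmonicSum (admissible_two hj (by omega)))

/-! ### Shuffle products: triangular sums and partial fractions. -/

theorem tendsto_cauchy_product {i k : ℕ} (hi : 2 ≤ i) (hk : 2 ≤ k) :
    Tendsto (fun N => ∑ p ∈ Finset.range N, ∑ q ∈ Finset.HasAntidiagonal.antidiagonal p,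
      1 / ((q.1 : ℝ) + 1) ^ i * (1 / ((q.2 : ℝ) + 1) ^ k)) atTop (𝓝 (mzv ![i] * mzv ![k])) := by
  have hs : ∀ s : ℕ, 2 ≤ s → Summable (fun x : ℕ => ‖1 / ((x : ℝ) + 1) ^ s‖) := by
    intro s hs
    have := (summable_nat_add_iff 1).2 (Real.summable_one_div_nat_pow.2 (by omega : 1 < s))
    simpa using this.norm
  have hz : ∀ s : ℕ, 2 ≤ s → mzv ![s] = ∑' x : ℕ, 1 / ((x : ℝ) + 1) ^ s := by
    intro s h
    refine tendsto_nhds_unique (tendsto_harmonicSum (admissible_one h)) ?_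
    exact ((hs s h).of_norm.hasSum.tendsto_sum_nat).congr fun N => (harmonicSum_one s N).symm
  rw [hz i hi, hz k hk, tsum_mul_tsum_eq_tsum_sum_antidiagonal_of_summable_norm (hs i hi) (hs k hk)]
  exact (summable_norm_sum_mul_antidiagonal_of_summable_norm
    (hs i hi) (hs k hk)).of_norm.hasSum.tendsto_sum_nat

/-- On the triangle `x + y ≤ N + 1` the substitution `k₁ = x + y`, `k₂ = y` gives exactly a
truncated double sum; the missing value `k₁ = 1` has no `k₂` below it. -/
theorem sum_antidiagonal_snd (j k N : ℕ) :
    ∑ p ∈ Finset.range N, ∑ q ∈ Finset.HasAntidiagonal.antidiagonal p,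
      (1 / ((q.1 : ℝ) + 1 + (q.2 + 1))) ^ j * (1 / ((q.2 : ℝ) + 1)) ^ k =
    harmonicSum ![j, k] (N + 1) := by
  rw [harmonicSum_succ, Finset.sum_range_succ']
  simp only [Matrix.cons_val_zero]
  have e0 : harmonicSum (Fin.tail ![j, k]) 0 = 0 := by simp [harmonicSum]
  rw [e0, mul_zero, add_zero]
  refine Finset.sum_congr rfl fun p _ => ?_
  have e1 : Fin.tail ![j, k] = ![k] := rfl
  rw [e1, harmonicSum_one, Finset.mul_sum, ← Finset.Nat.sum_antidiagonal_swap,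
    Finset.Nat.sum_antidiagonal_eq_sum_range_succ_mk]
  refine Finset.sum_congr rfl fun x hx => ?_
  have hx' : x ≤ p := by
    have := Finset.mem_range.1 hx
    omega
  simp only [Prod.swap, Nat.cast_sub hx', one_div_pow]
  push_cast
  congr 3
  ring

theorem sum_antidiagonal_fst (j k N : ℕ) :
    ∑ p ∈ Finset.range N, ∑ q ∈ Finset.HasAntidiagonal.antidiagonal p,
      (1 / ((q.1 : ℝ) + 1 + (q.2 + 1))) ^ j * (1 / ((q.1 : ℝ) + 1)) ^ k =
    harmonicSum ![j, k] (N + 1) := by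
  rw [← sum_antidiagonal_snd]
  refine Finset.sum_congr rfl fun p _ => ?_
  rw [← Finset.Nat.sum_antidiagonal_swap]
  refine Finset.sum_congr rfl fun q _ => ?_
  simp only [Prod.fst_swap, Prod.snd_swap]
  rw [add_comm ((q.2 : ℝ) + 1)]

/-- The hypotheses give `(w - v) * u = p * (u - v)` and `(w - u) * v = q * (v - u)`. After
multiplication by `u - v` all three sums telescope and the powers of `w` cancel. It is used with `u
= a/x`, `v = b/y`, `p = a/(x+y)`, `q = b/(x+y)`, and so handles all partial fractions of one weight
at once. -/
theorem mul_geom_sum₂ {u v w p q : ℝ} (hw : w = p + q) (h : u * v = p * v + q * u) (M : ℕ) :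
    u * v * ∑ i ∈ Finset.range M, u ^ i * v ^ (M - 1 - i) =
      p * (v * ∑ i ∈ Finset.range M, w ^ i * v ^ (M - 1 - i))
        + q * (u * ∑ i ∈ Finset.range M, w ^ i * u ^ (M - 1 - i)) := by
  have h1 := geom_sum₂_mul u v M
  have h2 := geom_sum₂_mul w v M
  have h3 := geom_sum₂_mul w u M
  have hv : (w - v) * u = p * (u - v) := by rw [hw]; linear_combination -h
  have hu : (w - u) * v = q * (v - u) := by rw [hw]; linear_combination -h
  by_cases huv : u = v
  · subst huv
    rcases eq_or_ne u 0 with h0 | h0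
    · simp [h0]
    · have : w = u := by
        have : (w - u) * u = 0 := by rw [hv]; ring
        rcases mul_eq_zero.1 this with h | h
        · linarith
        · exact absurd h h0
      rw [this]
      linear_combination (∑ i ∈ Finset.range M, u ^ i * u ^ (M - 1 - i)) * h
  · refine mul_right_cancel₀ (sub_ne_zero.2 huv) ?_
    generalize (∑ i ∈ Finset.range M, u ^ i * v ^ (M - 1 - i)) = A at *
    generalize (∑ i ∈ Finset.range M, w ^ i * v ^ (M - 1 - i)) = B at *
    generalize (∑ i ∈ Finset.range M, w ^ i * u ^ (M - 1 - i)) = C at *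
    linear_combination u * v * h1 - u * v * h2 + u * v * h3 + v * B * hv - u * C * hu

theorem mul_geom_sum₂_eq_sum_Ico (w v : ℝ) {M : ℕ} (hM : 1 ≤ M) :
    v * ∑ i ∈ Finset.range M, w ^ i * v ^ (M - 1 - i) =
      v ^ M + ∑ j ∈ Finset.Ico 2 (M + 1), w ^ (j - 1) * v ^ (M + 1 - j) := by
  obtain ⟨L, rfl⟩ : ∃ L, M = L + 1 := ⟨M - 1, by omega⟩
  rw [Finset.sum_Ico_eq_sum_range, Finset.sum_range_succ', mul_add, add_comm, Finset.mul_sum]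
  congr 1
  · simp [pow_succ']
  · refine Finset.sum_congr (by congr 1) fun i hi => ?_
    have := Finset.mem_range.1 hi
    rw [show 2 + i - 1 = i + 1 by omega, show L + 1 + 1 - (2 + i) = L + 1 - 1 - (i + 1) + 1 by omega,
      pow_succ v]
    ring

theorem partial_fraction (a b : ℝ) {x y : ℝ} (hx : 0 < x) (hy : 0 < y) {M : ℕ} (hM : 2 ≤ M) :
    ∑ i ∈ Finset.Ico 2 M, a ^ i * b ^ (M + 1 - i) * (1 / x ^ i * (1 / y ^ (M + 1 - i))) =
      ∑ j ∈ Finset.Ico 2 (M + 1),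
        ((a * (a + b) ^ (j - 1) * b ^ (M + 1 - j) - a * b ^ M)
            * ((1 / (x + y)) ^ j * (1 / y) ^ (M + 1 - j))
          + (b * (a + b) ^ (j - 1) * a ^ (M + 1 - j) - b * a ^ M)
            * ((1 / (x + y)) ^ j * (1 / x) ^ (M + 1 - j)))
      - a * b ^ M * ((1 / (x + y)) ^ M * (1 / x) ^ 1)
      - b * a ^ M * ((1 / (x + y)) ^ M * (1 / y) ^ 1) := by
  obtain ⟨r, hr⟩ : ∃ r, r = 1 / (x + y) := ⟨_, rfl⟩
  obtain ⟨s, hs⟩ : ∃ s, s = 1 / x := ⟨_, rfl⟩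
  obtain ⟨t, ht⟩ : ∃ t, t = 1 / y := ⟨_, rfl⟩
  have hst : s * t = r * s + r * t := by rw [hr, hs, ht]; field_simp; ring
  have hM1 : 1 ≤ M := by omega
  have K := mul_geom_sum₂ (u := a * s) (v := b * t) (w := (a + b) * r) (p := a * r) (q := b * r)
    (by ring) (by linear_combination a * b * hst) M
  rw [mul_geom_sum₂_eq_sum_Ico _ _ hM1, mul_geom_sum₂_eq_sum_Ico _ _ hM1, mul_assoc (a * s),
    mul_geom_sum₂_eq_sum_Ico _ _ hM1, Finset.sum_Ico_succ_top hM, mul_add, mul_add, Finset.mul_sum]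
    at K
  -- The case of unit weights: it replaces the difference of the non-summable `1/(x y^M)` and
  -- `1/((x+y) y^M)` by summable terms. Hence the corrections `-a * b ^ M` and `-b * a ^ M` in the
  -- statement.
  have geo : ∀ z z' : ℝ, z * z' = r * z + r * z' →
      z * z' ^ M = z' ^ M * r + ∑ j ∈ Finset.Ico 2 (M + 1), r ^ j * z' ^ (M + 1 - j)
        + z * r ^ M := by
    intro z z' hz
    have h1 := mul_geom_sum₂_eq_sum_Ico r z' hM1
    have h2 := geom_sum₂_mul r z' M
    have h3 : ∑ j ∈ Finset.Ico 2 (M + 1), r ^ j * z' ^ (M + 1 - j)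
        = r * ∑ j ∈ Finset.Ico 2 (M + 1), r ^ (j - 1) * z' ^ (M + 1 - j) := by
      rw [Finset.mul_sum]
      refine Finset.sum_congr rfl fun j hj => ?_
      have := (Finset.mem_Ico.1 hj).1
      obtain ⟨i, rfl⟩ : ∃ i, j = i + 1 := ⟨j - 1, by omega⟩
      rw [Nat.add_sub_cancel]
      ring
    rw [h3]
    generalize (∑ i ∈ Finset.range M, r ^ i * z' ^ (M - 1 - i)) = A at *
    linear_combination r * h1 + A * hz + z * h2
  have g1 := geo s t hst
  have g2 := geo t s (by linear_combination hst)
  rw [← hr, ← hs, ← ht, Finset.sum_add_distrib]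
  simp only [sub_mul, Finset.sum_sub_distrib, ← Finset.mul_sum]
  have e1 : ∑ i ∈ Finset.Ico 2 M, a ^ i * b ^ (M + 1 - i) * (1 / x ^ i * (1 / y ^ (M + 1 - i)))
      = ∑ i ∈ Finset.Ico 2 M, a * s * ((a * s) ^ (i - 1) * (b * t) ^ (M + 1 - i)) := by
    refine Finset.sum_congr rfl fun i hi => ?_
    have := (Finset.mem_Ico.1 hi).1
    rw [← mul_assoc (a * s), ← pow_succ', Nat.sub_add_cancel (by omega), ← one_div_pow,
      ← one_div_pow, ← hs, ← ht]
    ring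
  have e2 : ∀ α β z : ℝ, ∑ j ∈ Finset.Ico 2 (M + 1),
      α * (a + b) ^ (j - 1) * β ^ (M + 1 - j) * (r ^ j * z ^ (M + 1 - j)) =
      α * r * ∑ j ∈ Finset.Ico 2 (M + 1), ((a + b) * r) ^ (j - 1) * (β * z) ^ (M + 1 - j) := by
    intro α β z
    rw [Finset.mul_sum]
    refine Finset.sum_congr rfl fun j hj => ?_
    have := (Finset.mem_Ico.1 hj).1
    obtain ⟨i, rfl⟩ : ∃ i, j = i + 1 := ⟨j - 1, by omega⟩
    rw [Nat.add_sub_cancel, mul_pow, mul_pow]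
    ring
  have e3 : a * s * ((a * s) ^ (M - 1) * (b * t) ^ (M + 1 - M)) = a ^ M * s ^ M * (b * t) := by
    rw [← mul_assoc, ← pow_succ', Nat.sub_add_cancel hM1, Nat.add_sub_cancel_left]
    ring
  rw [e1, e2, e2]
  rw [e3] at K
  simp only [mul_pow] at K ⊢
  linear_combination K - a * b ^ M * g1 - b * a ^ M * g2

/-! ### The weighted sum formula in depth two. -/

/-- The weight of `ζ(j, k)` in the weighted sum formula in depth two. -/
def doubleWeight (a b : ℝ) (j k : ℕ) : ℝ :=
  a * (a + b) ^ (j - 1) * b ^ k + b * (a + b) ^ (j - 1) * a ^ k - a ^ j * b ^ k - b ^ j * a ^ k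
    - a ^ (j + k - 1) * b - b ^ (j + k - 1) * a

/-- The coefficient of `ζ(m)` in the weighted sum formula in depth two. -/
def singleWeight (a b : ℝ) (m : ℕ) : ℝ :=
  ∑ i ∈ Finset.Ico 2 (m - 1), a ^ i * b ^ (m - i)

theorem sum_pairs (m : ℕ) (f : ℕ → ℕ → ℝ) :
    ∑ p ∈ pairs m, f p.1 p.2 = ∑ j ∈ Finset.Ico 2 m, f j (m - j) := by
  refine Finset.sum_nbij' (fun p => p.1) (fun j => (j, m - j)) ?_ ?_ ?_ ?_ ?_ <;>
    simp only [pairs, Finset.mem_filter, Finset.mem_product, Finset.mem_Icc, Finset.mem_Ico,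
      Prod.forall, Prod.mk.injEq]
  · intro j k h
    omega
  · intro j h
    omega
  · intro j k h
    exact ⟨trivial, by omega⟩
  · exact fun _ _ => trivial
  · rintro j k h
    rw [show m - j = k by omega]

theorem shuffle_sum (a b : ℝ) {M : ℕ} (hM : 2 ≤ M) :
    ∑ i ∈ Finset.Ico 2 M, a ^ i * b ^ (M + 1 - i) * (mzv ![i] * mzv ![M + 1 - i]) =
      ∑ j ∈ Finset.Ico 2 (M + 1),
        (a * (a + b) ^ (j - 1) * b ^ (M + 1 - j) - a * b ^ M
          + (b * (a + b) ^ (j - 1) * a ^ (M + 1 - j) - b * a ^ M)) * mzv ![j, M + 1 - j]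
      - (a * b ^ M + b * a ^ M) * mzv ![M, 1] := by
  have h2 : ∀ j k : ℕ, 2 ≤ j → 1 ≤ k →
      Tendsto (fun N => harmonicSum ![j, k] (N + 1)) atTop (𝓝 (mzv ![j, k])) := fun j k hj hk =>
    (tendsto_harmonicSum (admissible_two hj hk)).comp (tendsto_add_atTop_nat 1)
  have L : Tendsto (fun N => ∑ i ∈ Finset.Ico 2 M, a ^ i * b ^ (M + 1 - i) *
      ∑ p ∈ Finset.range N, ∑ q ∈ Finset.HasAntidiagonal.antidiagonal p,
        1 / ((q.1 : ℝ) + 1) ^ i * (1 / ((q.2 : ℝ) + 1) ^ (M + 1 - i))) atTop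
      (𝓝 (∑ i ∈ Finset.Ico 2 M, a ^ i * b ^ (M + 1 - i) * (mzv ![i] * mzv ![M + 1 - i]))) := by
    refine tendsto_finsetSum _ fun i hi => ?_
    have := Finset.mem_Ico.1 hi
    exact (tendsto_cauchy_product (by omega) (by omega)).const_mul _
  have R : Tendsto (fun N => ∑ j ∈ Finset.Ico 2 (M + 1),
        (a * (a + b) ^ (j - 1) * b ^ (M + 1 - j) - a * b ^ M
          + (b * (a + b) ^ (j - 1) * a ^ (M + 1 - j) - b * a ^ M))
          * harmonicSum ![j, M + 1 - j] (N + 1)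
      - (a * b ^ M + b * a ^ M) * harmonicSum ![M, 1] (N + 1)) atTop
      (𝓝 (∑ j ∈ Finset.Ico 2 (M + 1),
        (a * (a + b) ^ (j - 1) * b ^ (M + 1 - j) - a * b ^ M
          + (b * (a + b) ^ (j - 1) * a ^ (M + 1 - j) - b * a ^ M)) * mzv ![j, M + 1 - j]
      - (a * b ^ M + b * a ^ M) * mzv ![M, 1])) := by
    refine (tendsto_finsetSum _ fun j hj => ?_).sub ((h2 M 1 hM le_rfl).const_mul _)
    have := Finset.mem_Ico.1 hj
    exact (h2 _ _ (by omega) (by omega)).const_mul _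
  refine tendsto_nhds_unique L (R.congr fun N => ?_)
  have E : ∀ q : ℕ × ℕ, _ := fun q => partial_fraction a b (x := (q.1 : ℝ) + 1)
    (y := (q.2 : ℝ) + 1) (by positivity) (by positivity) hM
  have E' : ∑ p ∈ Finset.range N, ∑ q ∈ Finset.HasAntidiagonal.antidiagonal p, _ =
    ∑ p ∈ Finset.range N, ∑ q ∈ Finset.HasAntidiagonal.antidiagonal p, _ :=
    Finset.sum_congr rfl fun p _ => Finset.sum_congr rfl fun q _ => E q
  simp only [Finset.sum_sub_distrib, ← Finset.mul_sum] at E'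
  rw [sum_antidiagonal_fst, sum_antidiagonal_snd] at E'
  have c1 : ∀ f : ℕ → ℕ × ℕ → ℝ, ∀ s : Finset ℕ,
      ∑ p ∈ Finset.range N, ∑ q ∈ Finset.HasAntidiagonal.antidiagonal p, ∑ i ∈ s, f i q =
        ∑ i ∈ s, ∑ p ∈ Finset.range N, ∑ q ∈ Finset.HasAntidiagonal.antidiagonal p, f i q := by
    intro f s
    rw [Finset.sum_comm]
    exact Finset.sum_congr rfl fun p _ => Finset.sum_comm
  rw [c1, c1] at E'
  simp only [Finset.sum_add_distrib, ← Finset.mul_sum] at E'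
  simp only [sum_antidiagonal_fst, sum_antidiagonal_snd] at E'
  rw [E']
  simp only [add_mul, Finset.sum_add_distrib]
  ring

/-- The weighted sum formula in depth two. -/
theorem sum_doubleWeight (a b : ℝ) (m : ℕ) :
    ∑ j ∈ Finset.Ico 2 m, doubleWeight a b j (m - j) * mzv ![j, m - j] =
      singleWeight a b m * mzv ![m] := by
  rcases lt_or_ge m 3 with hm | hm
  · simp [singleWeight, Finset.Ico_eq_empty_of_le (show m ≤ 2 by omega),
      Finset.Ico_eq_empty_of_le (show m - 1 ≤ 2 by omega)]
  obtain ⟨M, rfl⟩ : ∃ M, m = M + 1 := ⟨m - 1, by omega⟩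
  have hM : 2 ≤ M := by omega
  have h1 := shuffle_sum a b hM
  have h2 : ∑ i ∈ Finset.Ico 2 M, a ^ i * b ^ (M + 1 - i) * (mzv ![i] * mzv ![M + 1 - i]) =
      ∑ i ∈ Finset.Ico 2 M, a ^ i * b ^ (M + 1 - i) * mzv ![i, M + 1 - i]
      + ∑ i ∈ Finset.Ico 2 M, b ^ i * a ^ (M + 1 - i) * mzv ![i, M + 1 - i]
      + singleWeight a b (M + 1) * mzv ![M + 1] := by
    have h3 := Finset.sum_Ico_reflect
      (fun i => b ^ i * a ^ (M + 1 - i) * mzv ![i, M + 1 - i]) 2 (show M ≤ M + 1 + 1 by omega)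
    rw [show M + 1 + 1 - M = 2 by omega, show M + 1 + 1 - 2 = M by omega] at h3
    rw [← h3, singleWeight, Finset.sum_mul, Nat.add_sub_cancel, ← Finset.sum_add_distrib,
      ← Finset.sum_add_distrib]
    refine Finset.sum_congr rfl fun i hi => ?_
    have := Finset.mem_Ico.1 hi
    rw [mzv_one_mul_one (by omega) (by omega), Nat.sub_sub_self (by omega),
      Nat.add_sub_cancel' (by omega)]
    ring
  have h4 : ∑ j ∈ Finset.Ico 2 (M + 1), doubleWeight a b j (M + 1 - j) * mzv ![j, M + 1 - j] =
      ∑ j ∈ Finset.Ico 2 (M + 1),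
        (a * (a + b) ^ (j - 1) * b ^ (M + 1 - j) - a * b ^ M
          + (b * (a + b) ^ (j - 1) * a ^ (M + 1 - j) - b * a ^ M)) * mzv ![j, M + 1 - j]
      - ∑ j ∈ Finset.Ico 2 (M + 1), a ^ j * b ^ (M + 1 - j) * mzv ![j, M + 1 - j]
      - ∑ j ∈ Finset.Ico 2 (M + 1), b ^ j * a ^ (M + 1 - j) * mzv ![j, M + 1 - j] := by
    rw [← Finset.sum_sub_distrib, ← Finset.sum_sub_distrib]
    refine Finset.sum_congr rfl fun j hj => ?_
    have := Finset.mem_Ico.1 hj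
    rw [doubleWeight, Nat.add_sub_cancel' (show j ≤ M + 1 by omega), Nat.add_sub_cancel]
    ring
  -- The stuffle side stops at `i = M - 1`. The terms at `j = M` split off here cancel the `mzv ![M,
  -- 1]` term of `shuffle_sum`.
  rw [Finset.sum_Ico_succ_top hM (fun j => a ^ j * b ^ (M + 1 - j) * mzv ![j, M + 1 - j]),
    Finset.sum_Ico_succ_top hM (fun j => b ^ j * a ^ (M + 1 - j) * mzv ![j, M + 1 - j]),
    Nat.add_sub_cancel_left] at h4
  linear_combination h4 - h1 + h2

/-! ### Geometric sums and the coefficients of the double zetas. -/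

/-- The homogeneous geometric sum over the exponents `l ≥ 2` of `y`. -/
def tailSum (x y : ℝ) (K : ℕ) : ℝ :=
  ∑ l ∈ Finset.Ico 2 K, x ^ (K - l) * y ^ l

theorem tailSum_one (x y : ℝ) : tailSum x y 1 = 0 := by simp [tailSum]

theorem tailSum_add_two {x y : ℝ} (h : x ≠ y) (L : ℕ) :
    tailSum x y (L + 2) = (x ^ (L + 1) * y ^ 2 - x * y ^ (L + 2)) / (x - y) := by
  rw [eq_div_iff (sub_ne_zero.2 h), tailSum, Finset.sum_Ico_eq_sum_range, Nat.add_sub_cancel]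
  have h1 : ∑ i ∈ Finset.range L, x ^ (L + 2 - (2 + i)) * y ^ (2 + i) =
      x * y ^ 2 * ∑ i ∈ Finset.range L, y ^ i * x ^ (L - 1 - i) := by
    rw [Finset.mul_sum]
    refine Finset.sum_congr rfl fun i hi => ?_
    have := Finset.mem_range.1 hi
    rw [show L + 2 - (2 + i) = L - 1 - i + 1 by omega]
    ring
  rw [h1]
  linear_combination -(x * y ^ 2) * geom_sum₂_mul y x L

theorem singleWeight_eq_tailSum (a b : ℝ) {m : ℕ} (hm : 2 ≤ m) :
    singleWeight a b m = b * tailSum b a (m - 1) := by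
  rw [singleWeight, tailSum, Finset.mul_sum]
  refine Finset.sum_congr rfl fun i hi => ?_
  have := Finset.mem_Ico.1 hi
  rw [show m - i = m - 1 - i + 1 by omega]
  ring

/-- The coefficient of `ζ(j, k)` produced by the stuffle product. -/
def stuffleCoeff (a b c : ℝ) (j k : ℕ) : ℝ :=
  (if 2 ≤ k then c ^ j * singleWeight a b k + c ^ k * singleWeight a b j else 0)
    - ∑ l ∈ Finset.Ico 2 (j - 1), doubleWeight a b (j - l) k * c ^ l
    - ∑ l ∈ Finset.Ico 2 k, doubleWeight a b j (k - l) * c ^ l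

/-- For `j ≥ 1` the weight factors as `(a b^k + b a^k) ((a+b)^(j-1) - a^(j-1) - b^(j-1))`, so
summing over the first index leaves three geometric sums. -/
theorem sum_doubleWeight_fst (a b c : ℝ) (j k : ℕ) :
    ∑ l ∈ Finset.Ico 2 (j - 1), doubleWeight a b (j - l) k * c ^ l =
      (a * b ^ k + b * a ^ k)
        * (tailSum (a + b) c (j - 1) - tailSum a c (j - 1) - tailSum b c (j - 1)) := by
  simp only [tailSum]
  rw [← Finset.sum_sub_distrib, ← Finset.sum_sub_distrib, Finset.mul_sum]
  refine Finset.sum_congr rfl fun l hl => ?_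
  have := Finset.mem_Ico.1 hl
  obtain ⟨i, hi⟩ : ∃ i, j - l = i + 1 := ⟨j - l - 1, by omega⟩
  rw [doubleWeight, hi, show j - 1 - l = i by omega, show i + 1 + k - 1 = i + k by omega,
    Nat.add_sub_cancel]
  ring

theorem sum_doubleWeight_snd (a b c : ℝ) (j k : ℕ) :
    ∑ l ∈ Finset.Ico 2 k, doubleWeight a b (j + 1) (k - l) * c ^ l =
      (a * (a + b) ^ j - a ^ (j + 1) - a * b ^ j) * tailSum b c k
        + (b * (a + b) ^ j - b ^ (j + 1) - b * a ^ j) * tailSum a c k := by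
  simp only [tailSum]
  rw [Finset.mul_sum, Finset.mul_sum, ← Finset.sum_add_distrib]
  refine Finset.sum_congr rfl fun l hl => ?_
  have := Finset.mem_Ico.1 hl
  obtain ⟨i, hi⟩ : ∃ i, k - l = i + 1 := ⟨k - l - 1, by omega⟩
  rw [doubleWeight, hi, show j + 1 + (i + 1) - 1 = j + i + 1 by omega, Nat.add_sub_cancel]
  ring

theorem stuffleCoeff_one (a b c : ℝ) (j : ℕ) :
    stuffleCoeff a b c j 1 =
      -(2 * a * b * (tailSum (a + b) c (j - 1) - tailSum a c (j - 1) - tailSum b c (j - 1))) := by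
  rw [stuffleCoeff, sum_doubleWeight_fst, if_neg (by norm_num), Finset.Ico_eq_empty (by norm_num),
    Finset.sum_empty]
  ring

theorem stuffleCoeff_of_two_le (a b c : ℝ) {j k : ℕ} (hj : 2 ≤ j) (hk : 2 ≤ k) :
    stuffleCoeff a b c j k =
      c ^ j * (b * tailSum b a (k - 1)) + c ^ k * (b * tailSum b a (j - 1))
      - (a * b ^ k + b * a ^ k)
        * (tailSum (a + b) c (j - 1) - tailSum a c (j - 1) - tailSum b c (j - 1))
      - ((a * (a + b) ^ (j - 1) - a ^ j - a * b ^ (j - 1)) * tailSum b c k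
        + (b * (a + b) ^ (j - 1) - b ^ j - b * a ^ (j - 1)) * tailSum a c k) := by
  obtain ⟨i, rfl⟩ : ∃ i, j = i + 1 := ⟨j - 1, by omega⟩
  rw [stuffleCoeff, if_pos hk, sum_doubleWeight_fst, sum_doubleWeight_snd,
    singleWeight_eq_tailSum _ _ hj, singleWeight_eq_tailSum _ _ hk]
  rfl

/-! ### Polynomial forms of the three coefficients. -/

/-- The coefficient `S_n` as a polynomial. -/
def subleadingPoly (n : ℕ) (a b c : ℝ) : ℝ :=
  cyc₂ (fun a b =>
      a * c * (a + b) ^ (n - 2) - a ^ (n - 1) * c - c ^ (n - 1) * a - 2 * a * b ^ (n - 2) * c) a b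
    + a * b * c * ∑ i ∈ Finset.range (n - 2), a ^ i * b ^ (n - 2 - 1 - i)

theorem subleadingPoly_eq {n : ℕ} (hn : 2 ≤ n) {a b c : ℝ} (h : (a, b, c) ∈ generic) :
    subleadingPoly n a b c = subleadingCoeff n a b c := by
  have hab : a - b ≠ 0 := sub_ne_zero.2 h.2.2.1
  have hba : b - a ≠ 0 := sub_ne_zero.2 (Ne.symm h.2.2.1)
  obtain ⟨m, rfl⟩ : ∃ m, n = m + 2 := ⟨n - 2, by omega⟩
  have h1 := geom_sum₂_mul a b m
  rw [← eq_div_iff hab] at h1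
  simp only [subleadingPoly, subleadingCoeff, cyc₂, Nat.add_sub_cancel,
    show m + 2 - 1 = m + 1 by omega]
  rw [h1, add_comm b a]
  generalize (a + b) ^ m = s
  rw [← neg_sub b a] at hab ⊢
  field_simp
  ring

/-- The coefficient `D_{j,k}` as a polynomial. -/
def doublePoly (a b c : ℝ) (j k : ℕ) : ℝ :=
  stuffleCoeff a b c j k + (if k = 1 then subleadingPoly (j + k) a b c else 0)
    - (if k = 2 then a * b * c ^ (j + k - 2) else 0)
    - (if j = 2 then cyc₃ (fun a b c => a ^ (j + k - 2) * b * c) a b c else 0)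
    + (if j + k = 3 then a * b * c else 0)

/-- At `L = 0` the quotient is `-y` while the sum is empty. This defect is the source of the
exceptional terms in `doublePoly`. -/
theorem tailSum_succ {x y : ℝ} (h : x ≠ y) (L : ℕ) :
    tailSum x y (L + 1) =
      (x ^ L * y ^ 2 - x * y ^ (L + 1)) / (x - y) + if L = 0 then y else 0 := by
  have hxy := sub_ne_zero.2 h
  cases L with
  | zero =>
    simp only [zero_add, tailSum_one, if_true]
    field_simp
    ring
  | succ L => simp [tailSum_add_two h]

theorem doubleCoeff_rational_one {a b c : ℝ} (h : (a, b, c) ∈ generic) (j : ℕ) :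
    doubleCoeff a b c (j + 2) 1 - subleadingCoeff (j + 3) a b c =
      -(2 * a * b * (((a + b) ^ j * c ^ 2 - (a + b) * c ^ (j + 1)) / (a + b - c)
        - (a ^ j * c ^ 2 - a * c ^ (j + 1)) / (a - c)
        - (b ^ j * c ^ 2 - b * c ^ (j + 1)) / (b - c))) := by
  obtain ⟨hb, hc, hab, hac, hbc, hs⟩ := h
  have h1 : c - b ≠ 0 := sub_ne_zero.2 (Ne.symm hbc)
  have h2 : a - c ≠ 0 := sub_ne_zero.2 hac
  have h3 : b - a ≠ 0 := sub_ne_zero.2 (Ne.symm hab)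
  have h4 : c - b - a ≠ 0 := by
    intro h
    exact hs (by linear_combination h)
  simp only [doubleCoeff, subleadingCoeff, cyc₂, cyc₃, show j + 2 - 1 = j + 1 by omega,
    Nat.add_sub_cancel, show j + 2 + 1 - 2 = j + 1 by omega, show 1 + (j + 2) - 2 = j + 1 by omega,
    show j + 3 - 1 = j + 2 by omega, Nat.sub_self]
  rw [add_comm b a, show a - b = -(b - a) by ring, show c - a = -(a - c) by ring,
    show b - c = -(c - b) by ring, show a + b - c = -(c - b - a) by ring,
    show -(a - c) - b = c - b - a by ring]
  -- Once the powers with exponent `j` are independent symbols, the claim is an identity of rational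
  -- functions.
  simp only [pow_succ (a + b) j]
  generalize (a + b) ^ j = s
  simp only [pow_add]
  generalize a ^ j = A
  generalize b ^ j = B
  generalize c ^ j = C
  field_simp
  ring

theorem doubleCoeff_rational {a b c : ℝ} (h : (a, b, c) ∈ generic) (j k : ℕ) :
    doubleCoeff a b c (j + 2) (k + 2) =
      c ^ (j + 2) * (b * ((b ^ k * a ^ 2 - b * a ^ (k + 1)) / (b - a)))
      + c ^ (k + 2) * (b * ((b ^ j * a ^ 2 - b * a ^ (j + 1)) / (b - a)))
      - (a * b ^ (k + 2) + b * a ^ (k + 2))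
        * (((a + b) ^ j * c ^ 2 - (a + b) * c ^ (j + 1)) / (a + b - c)
        - (a ^ j * c ^ 2 - a * c ^ (j + 1)) / (a - c)
        - (b ^ j * c ^ 2 - b * c ^ (j + 1)) / (b - c))
      - ((a * (a + b) ^ (j + 1) - a ^ (j + 2) - a * b ^ (j + 1))
          * ((b ^ (k + 1) * c ^ 2 - b * c ^ (k + 2)) / (b - c))
        + (b * (a + b) ^ (j + 1) - b ^ (j + 2) - b * a ^ (j + 1))
          * ((a ^ (k + 1) * c ^ 2 - a * c ^ (k + 2)) / (a - c))) := by
  obtain ⟨hb, hc, hab, hac, hbc, hs⟩ := h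
  have h1 : c - b ≠ 0 := sub_ne_zero.2 (Ne.symm hbc)
  have h2 : a - c ≠ 0 := sub_ne_zero.2 hac
  have h3 : b - a ≠ 0 := sub_ne_zero.2 (Ne.symm hab)
  have h4 : c - b - a ≠ 0 := by
    intro h
    exact hs (by linear_combination h)
  simp only [doubleCoeff, cyc₂, cyc₃, show j + 2 - 1 = j + 1 by omega,
    show k + 2 - 1 = k + 1 by omega,
    Nat.add_sub_cancel, show j + 2 + (k + 2) - 2 = j + k + 2 by omega,
    show k + 2 + (j + 2) - 2 = j + k + 2 by omega]
  rw [add_comm b a, show c - a = -(a - c) by ring,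
    show b - c = -(c - b) by ring, show a + b - c = -(c - b - a) by ring,
    show -(a - c) - b = c - b - a by ring]
  simp only [pow_succ (a + b) j]
  generalize (a + b) ^ j = s
  simp only [pow_add]
  generalize a ^ j = A
  generalize b ^ j = B
  generalize c ^ j = C
  generalize a ^ k = A'
  generalize b ^ k = B'
  generalize c ^ k = C'
  field_simp
  ring

theorem doublePoly_eq {j k : ℕ} (hj : 2 ≤ j) (hk : 1 ≤ k) {a b c : ℝ}
    (h : (a, b, c) ∈ generic) : doublePoly a b c j k = doubleCoeff a b c j k := by
  have hab : b ≠ a := Ne.symm h.2.2.1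
  have hac : a ≠ c := h.2.2.2.1
  have hbc : b ≠ c := h.2.2.2.2.1
  have hs : a + b ≠ c := Ne.symm h.2.2.2.2.2
  obtain ⟨j, rfl⟩ : ∃ i, j = i + 2 := ⟨j - 2, by omega⟩
  rcases eq_or_lt_of_le hk with rfl | hk
  · have K := doubleCoeff_rational_one h j
    rw [doublePoly, stuffleCoeff_one, if_pos rfl, if_neg (by norm_num),
      subleadingPoly_eq (by omega) h, show j + 2 - 1 = j + 1 by omega, tailSum_succ hs,
      tailSum_succ hac, tailSum_succ hbc]
    rw [show j + 2 + 1 = j + 3 by omega]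
    rcases eq_or_ne j 0 with rfl | hj
    · simp only [if_true, cyc₃]
      norm_num at K ⊢
      linear_combination -K
    · simp only [if_neg hj, if_neg (show ¬ j + 2 = 2 by omega), if_neg (show ¬ j + 3 = 3 by omega)]
      linear_combination -K
  · obtain ⟨k, rfl⟩ : ∃ i, k = i + 2 := ⟨k - 2, by omega⟩
    have K := doubleCoeff_rational h j k
    rw [doublePoly, stuffleCoeff_of_two_le _ _ _ hj hk, if_neg (show ¬ k + 2 = 1 by omega),
      if_neg (show ¬ j + 2 + (k + 2) = 3 by omega), show j + 2 - 1 = j + 1 by omega,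
      show k + 2 - 1 = k + 1 by omega, tailSum_succ hs, tailSum_succ hac, tailSum_succ hbc,
      tailSum_succ hab, tailSum_succ hab, tailSum_add_two hac, tailSum_add_two hbc, K,
      show j + 2 + (k + 2) - 2 = j + k + 2 by omega]
    rcases eq_or_ne j 0 with rfl | hj <;> rcases eq_or_ne k 0 with rfl | hk
    · simp only [if_true, cyc₃]
      ring
    · simp only [if_true, if_neg hk, if_neg (show ¬ k + 2 = 2 by omega), cyc₃]
      ring
    · simp only [if_true, if_neg hj, if_neg (show ¬ j + 2 = 2 by omega), cyc₃]
      ring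
    · simp only [if_neg hj, if_neg hk, if_neg (show ¬ j + 2 = 2 by omega),
        if_neg (show ¬ k + 2 = 2 by omega)]
      ring

/-- The coefficient `Z_n` as a polynomial. -/
def singlePoly (n : ℕ) (a b c : ℝ) : ℝ :=
  ∑ l ∈ Finset.Ico 2 (n - 1), c ^ l * singleWeight a b (n - l)
    - b * c * a ^ (n - 2)
    + (if n = 2 then 1 else 0) * (a * b + a * c + b * c)
    + (if n = 3 then 1 else 0) * (a * b * c)

theorem sum_singleWeight {n : ℕ} (hn : 3 ≤ n) {a b : ℝ} (h : b ≠ a) (c : ℝ) :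
    ∑ l ∈ Finset.Ico 2 (n - 1), c ^ l * singleWeight a b (n - l) =
      b / (b - a) * (a ^ 2 * tailSum b c (n - 2) - b * a * tailSum a c (n - 2)) := by
  obtain ⟨m, rfl⟩ : ∃ m, n = m + 3 := ⟨n - 3, by omega⟩
  rw [show m + 3 - 1 = m + 2 by omega, show m + 3 - 2 = m + 1 by omega]
  rcases Nat.eq_zero_or_pos m with rfl | hm
  · simp [tailSum]
  -- The top index `l = n - 2` meets the empty `singleWeight a b 2`; dropping it matches the range
  -- of `tailSum`.
  rw [Finset.sum_Ico_succ_top (by omega)]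
  have e : singleWeight a b (m + 3 - (m + 1)) = 0 := by
    simp [singleWeight]
  rw [e, mul_zero, add_zero, tailSum, tailSum, Finset.mul_sum, Finset.mul_sum,
    ← Finset.sum_sub_distrib, Finset.mul_sum]
  refine Finset.sum_congr rfl fun l hl => ?_
  have := Finset.mem_Ico.1 hl
  obtain ⟨i, hi⟩ : ∃ i, m + 1 - l = i + 1 := ⟨m - l, by omega⟩
  rw [singleWeight_eq_tailSum _ _ (by omega), hi, show m + 3 - l - 1 = i + 2 by omega,
    tailSum_add_two h]
  ring

theorem singlePoly_eq {n : ℕ} (hn : 2 ≤ n) {a b c : ℝ} (h : (a, b, c) ∈ generic) :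
    singlePoly n a b c = singleCoeff n a b c := by
  obtain ⟨hb, hc, hab, hac, hbc, -⟩ := h
  have h1 : c - b ≠ 0 := sub_ne_zero.2 (Ne.symm hbc)
  have h2 : a - c ≠ 0 := sub_ne_zero.2 hac
  have h3 : b - a ≠ 0 := sub_ne_zero.2 (Ne.symm hab)
  simp only at hb hc
  simp only [singlePoly, singleCoeff, cyc₂]
  rcases eq_or_lt_of_le hn with rfl | hn
  · rw [show a - c = -(c - a) by ring, neg_ne_zero] at h2
    rw [show b - c = -(c - b) by ring]
    simp [-neg_sub]
  rw [sum_singleWeight hn (Ne.symm hab)]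
  obtain ⟨m, rfl⟩ : ∃ m, n = m + 3 := ⟨n - 3, by omega⟩
  simp only [show m + 3 - 1 = m + 2 by omega, show m + 3 - 2 = m + 1 by omega]
  rw [tailSum_succ hbc, tailSum_succ hac, show a - c = -(c - a) by ring]
  rw [show a - c = -(c - a) by ring, neg_ne_zero] at h2
  rw [show b - c = -(c - b) by ring]
  rcases eq_or_ne m 0 with rfl | hm
  · simp [-neg_sub]
    field_simp
    ring
  · simp only [if_neg hm, if_neg (show ¬ m + 3 = 2 by omega), if_neg (show ¬ m + 3 = 3 by omega)]
    simp only [pow_add]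
    generalize a ^ m = A
    generalize b ^ m = B
    generalize c ^ m = C
    field_simp
    ring

theorem continuous_subleadingPoly (n : ℕ) :
    Continuous fun p : ℝ × ℝ × ℝ => subleadingPoly n p.1 p.2.1 p.2.2 := by
  unfold subleadingPoly cyc₂
  fun_prop

theorem continuous_singlePoly (n : ℕ) :
    Continuous fun p : ℝ × ℝ × ℝ => singlePoly n p.1 p.2.1 p.2.2 := by
  unfold singlePoly singleWeight
  fun_prop

theorem continuous_doublePoly (j k : ℕ) :
    Continuous fun p : ℝ × ℝ × ℝ => doublePoly p.1 p.2.1 p.2.2 j k := by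
  have := continuous_subleadingPoly (j + k)
  unfold doublePoly stuffleCoeff singleWeight doubleWeight cyc₃
  split_ifs <;> fun_prop

/-! ### Reindexing of sums over pairs and triples. -/

theorem mem_pairs {m : ℕ} {p : ℕ × ℕ} : p ∈ pairs m ↔ 2 ≤ p.1 ∧ 1 ≤ p.2 ∧ p.1 + p.2 = m := by
  simp only [pairs, Finset.mem_filter, Finset.mem_product, Finset.mem_Icc]
  omega

theorem mem_triples {m : ℕ} {p : ℕ × ℕ × ℕ} :
    p ∈ triples m ↔ 2 ≤ p.1 ∧ 1 ≤ p.2.1 ∧ 1 ≤ p.2.2 ∧ p.1 + p.2.1 + p.2.2 = m := by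
  simp only [triples, Finset.mem_filter, Finset.mem_product, Finset.mem_Icc]
  omega

/-- The triples `(j, k, l)` with `(j, k)` and `(l)` admissible and `j + k + l = n`. -/
def stuffleTriples (n : ℕ) : Finset (ℕ × ℕ × ℕ) :=
  (triples n).filter fun p => 2 ≤ p.2.2

theorem mem_stuffleTriples {n : ℕ} {p : ℕ × ℕ × ℕ} :
    p ∈ stuffleTriples n ↔ 2 ≤ p.1 ∧ 1 ≤ p.2.1 ∧ 2 ≤ p.2.2 ∧ p.1 + p.2.1 + p.2.2 = n := by
  simp only [stuffleTriples, Finset.mem_filter, mem_triples]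
  omega

theorem sum_triples_last (n : ℕ) (f : ℕ → ℕ → ℕ → ℝ) :
    ∑ p ∈ triples n, f p.1 p.2.1 p.2.2 =
      ∑ p ∈ stuffleTriples n, f p.1 p.2.1 p.2.2 + ∑ p ∈ pairs (n - 1), f p.1 p.2 1 := by
  rw [← Finset.sum_filter_add_sum_filter_not (triples n) fun p => 2 ≤ p.2.2]
  congr 1
  refine Finset.sum_nbij' (fun p => (p.1, p.2.1)) (fun p => (p.1, p.2, 1)) ?_ ?_ ?_ ?_ ?_ <;>
    simp only [Finset.mem_filter, mem_triples, mem_pairs, Prod.forall, Prod.mk.injEq]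
  · intro j k l h
    omega
  · intro j k h
    omega
  · intro j k l h
    exact ⟨trivial, trivial, by omega⟩
  · simp
  · intro j k l h
    rw [show l = 1 by omega]

theorem sum_triples_swap (n : ℕ) (f : ℕ → ℕ → ℕ → ℝ) :
    ∑ p ∈ triples n, f p.1 p.2.1 p.2.2 = ∑ p ∈ triples n, f p.1 p.2.2 p.2.1 := by
  refine Finset.sum_nbij' (fun p => (p.1, p.2.2, p.2.1)) (fun p => (p.1, p.2.2, p.2.1))
    ?_ ?_ ?_ ?_ ?_ <;> simp only [mem_triples, Prod.forall, implies_true]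
  all_goals
    intro j k l h
    omega

/-- For the stuffle word `ζ(l, j, k)` the constraint `j ≥ 2` falls on the middle entry, so the
leftover words are `ζ(l, 1, k)`. -/
theorem sum_triples_middle (n : ℕ) (f : ℕ → ℕ → ℕ → ℝ) :
    ∑ p ∈ triples n, f p.1 p.2.1 p.2.2 =
      ∑ p ∈ stuffleTriples n, f p.2.2 p.1 p.2.1 + ∑ p ∈ pairs (n - 1), f p.1 1 p.2 := by
  rw [sum_triples_swap, sum_triples_last n fun j k l => f j l k]
  congr 1
  refine Finset.sum_nbij' (fun p => (p.2.2, p.2.1, p.1)) (fun p => (p.2.2, p.2.1, p.1))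
    ?_ ?_ ?_ ?_ ?_ <;> simp only [mem_stuffleTriples, Prod.forall, implies_true]
  all_goals
    intro j k l h
    omega

theorem sum_stuffleTriples (n : ℕ) (f : ℕ → ℕ → ℕ → ℝ) :
    ∑ p ∈ stuffleTriples n, f p.1 p.2.1 p.2.2 =
      ∑ l ∈ Finset.Ico 2 (n - 1), ∑ p ∈ pairs (n - l), f p.1 p.2 l := by
  rw [Finset.sum_sigma']
  refine Finset.sum_nbij' (fun p => ⟨p.2.2, p.1, p.2.1⟩) (fun p => (p.2.1, p.2.2, p.1))
    ?_ ?_ ?_ ?_ ?_ <;>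
    simp only [mem_stuffleTriples, Finset.mem_sigma, Finset.mem_Ico, mem_pairs, Prod.forall,
      Sigma.forall, implies_true]
  all_goals
    intro j k l h
    omega

theorem sum_stuffleTriples_fst (n : ℕ) (f : ℕ → ℕ → ℕ → ℝ) :
    ∑ p ∈ stuffleTriples n, f p.1 p.2.1 p.2.2 =
      ∑ p ∈ pairs n, ∑ l ∈ Finset.Ico 2 (p.1 - 1), f (p.1 - l) p.2 l := by
  rw [Finset.sum_sigma']
  refine Finset.sum_nbij' (fun p => ⟨(p.1 + p.2.2, p.2.1), p.2.2⟩)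
    (fun p => (p.1.1 - p.2, p.1.2, p.2)) ?_ ?_ ?_ ?_ ?_ <;>
    simp only [mem_stuffleTriples, Finset.mem_sigma, Finset.mem_Ico, mem_pairs, Prod.forall,
      Sigma.forall, implies_true, Nat.add_sub_cancel]
  · intro j k l h
    omega
  · intro j k l h
    omega
  · intro j k l h
    rw [Nat.sub_add_cancel (by omega)]

theorem sum_stuffleTriples_snd (n : ℕ) (f : ℕ → ℕ → ℕ → ℝ) :
    ∑ p ∈ stuffleTriples n, f p.1 p.2.1 p.2.2 =
      ∑ p ∈ pairs n, ∑ l ∈ Finset.Ico 2 p.2, f p.1 (p.2 - l) l := by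
  rw [Finset.sum_sigma']
  refine Finset.sum_nbij' (fun p => ⟨(p.1, p.2.1 + p.2.2), p.2.2⟩)
    (fun p => (p.1.1, p.1.2 - p.2, p.2)) ?_ ?_ ?_ ?_ ?_ <;>
    simp only [mem_stuffleTriples, Finset.mem_sigma, Finset.mem_Ico, mem_pairs, Prod.forall,
      Sigma.forall, implies_true, Nat.add_sub_cancel]
  · intro j k l h
    omega
  · intro j k l h
    omega
  · intro j k l h
    rw [Nat.sub_add_cancel (by omega)]

theorem sum_pairs_of_two_le (n : ℕ) (f : ℕ → ℕ → ℝ) :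
    ∑ p ∈ pairs n, (if 2 ≤ p.2 then f p.1 p.2 else 0) =
      ∑ l ∈ Finset.Ico 2 (n - 1), f l (n - l) := by
  rw [← Finset.sum_filter]
  refine Finset.sum_nbij' (fun p => p.1) (fun l => (l, n - l)) ?_ ?_ ?_ ?_ ?_ <;>
    simp only [Finset.mem_filter, mem_pairs, Finset.mem_Ico, Prod.forall, Prod.mk.injEq,
      implies_true]
  · intro j k h
    omega
  · intro l h
    omega
  · intro j k h
    exact ⟨trivial, by omega⟩
  · intro j k h
    rw [show n - j = k by omega]

/-! ### Passage to depth three and conclusion. -/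

/-- The triple part of the weighted sum formula as a sum of stuffle products. -/
theorem triple_sum_eq (n : ℕ) (a b c : ℝ) :
    ∑ p ∈ triples n,
          (fun j k l : ℕ =>
            cyc₂ (fun a b =>
              a * (a + b) ^ (j - 1) * (b ^ k * c ^ l + b ^ l * c ^ k)
                + a * (a + b) ^ (k - 1) * b ^ l * c ^ j
                - cyc₃ (fun j k l => a ^ (j + k - 1) * b * c ^ l + a ^ j * b ^ k * c ^ l) j k l)
              a b * mzv ![j, k, l]) p.1 p.2.1 p.2.2
        - ∑ p ∈ pairs (n - 1),
            (fun j k : ℕ =>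
              cyc₂ (fun a b =>
                a * (a + b) ^ (j - 1) * b ^ k * c - a ^ (j + k - 1) * b * c - a ^ j * b ^ k * c)
                a b * mzv ![j, k, 1]) p.1 p.2
        - ∑ p ∈ pairs (n - 1),
            (fun j k : ℕ =>
              cyc₂ (fun a b =>
                a * (a + b) ^ (j - 1) * b ^ k * c - a ^ (j + k - 1) * b * c
                  - a ^ k * b * c ^ j - a ^ k * c * b ^ j)
                a b * mzv ![j, 1, k]) p.1 p.2 =
      ∑ p ∈ stuffleTriples n, doubleWeight a b p.1 p.2.1 * c ^ p.2.2 *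
        (mzv ![p.1, p.2.1, p.2.2] + mzv ![p.1, p.2.2, p.2.1] + mzv ![p.2.2, p.1, p.2.1]) := by
  -- One identity for each of the three stuffle words. The leftovers of `h2` and `h3` both involve
  -- `mzv ![j, 1, k]` and together form the second subtracted sum.
  have h1 := sum_triples_last n fun j k l => doubleWeight a b j k * c ^ l * mzv ![j, k, l]
  have h2 := sum_triples_last n fun j k l => doubleWeight a b j k * c ^ l * mzv ![j, l, k]
  have h3 := sum_triples_middle n fun j k l => doubleWeight a b k l * c ^ j * mzv ![j, k, l]
  rw [sum_triples_swap n fun j k l => doubleWeight a b j k * c ^ l * mzv ![j, l, k]] at h2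
  have e0 : ∑ p ∈ triples n,
          (fun j k l : ℕ =>
            cyc₂ (fun a b =>
              a * (a + b) ^ (j - 1) * (b ^ k * c ^ l + b ^ l * c ^ k)
                + a * (a + b) ^ (k - 1) * b ^ l * c ^ j
                - cyc₃ (fun j k l => a ^ (j + k - 1) * b * c ^ l + a ^ j * b ^ k * c ^ l) j k l)
              a b * mzv ![j, k, l]) p.1 p.2.1 p.2.2 =
      ∑ p ∈ triples n, doubleWeight a b p.1 p.2.1 * c ^ p.2.2 * mzv ![p.1, p.2.1, p.2.2]
      + ∑ p ∈ triples n, doubleWeight a b p.1 p.2.2 * c ^ p.2.1 * mzv ![p.1, p.2.1, p.2.2]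
      + ∑ p ∈ triples n, doubleWeight a b p.2.1 p.2.2 * c ^ p.1 * mzv ![p.1, p.2.1, p.2.2] := by
    rw [← Finset.sum_add_distrib, ← Finset.sum_add_distrib]
    refine Finset.sum_congr rfl fun p _ => ?_
    simp only [cyc₂, cyc₃, doubleWeight]
    rw [add_comm b a, add_comm p.2.2 p.1]
    ring
  have e1 : ∑ p ∈ pairs (n - 1),
            (fun j k : ℕ =>
              cyc₂ (fun a b =>
                a * (a + b) ^ (j - 1) * b ^ k * c - a ^ (j + k - 1) * b * c - a ^ j * b ^ k * c)
                a b * mzv ![j, k, 1]) p.1 p.2 =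
      ∑ p ∈ pairs (n - 1), doubleWeight a b p.1 p.2 * c ^ 1 * mzv ![p.1, p.2, 1] := by
    refine Finset.sum_congr rfl fun p _ => ?_
    simp only [cyc₂, doubleWeight]
    rw [add_comm b a]
    ring
  have e2 : ∑ p ∈ pairs (n - 1),
            (fun j k : ℕ =>
              cyc₂ (fun a b =>
                a * (a + b) ^ (j - 1) * b ^ k * c - a ^ (j + k - 1) * b * c
                  - a ^ k * b * c ^ j - a ^ k * c * b ^ j)
                a b * mzv ![j, 1, k]) p.1 p.2 =
      ∑ p ∈ pairs (n - 1), doubleWeight a b p.1 p.2 * c ^ 1 * mzv ![p.1, 1, p.2]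
      + ∑ p ∈ pairs (n - 1), doubleWeight a b 1 p.2 * c ^ p.1 * mzv ![p.1, 1, p.2] := by
    rw [← Finset.sum_add_distrib]
    refine Finset.sum_congr rfl fun p _ => ?_
    simp only [cyc₂, doubleWeight, Nat.sub_self, Nat.add_sub_cancel_left]
    rw [add_comm b a]
    ring
  rw [e0, e1, e2]
  simp only [mul_add, Finset.sum_add_distrib]
  linear_combination h1 + h2 + h3

theorem stuffle_triple_sum (n : ℕ) (a b c : ℝ) :
    ∑ p ∈ stuffleTriples n, doubleWeight a b p.1 p.2.1 * c ^ p.2.2 *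
        (mzv ![p.1, p.2.1, p.2.2] + mzv ![p.1, p.2.2, p.2.1] + mzv ![p.2.2, p.1, p.2.1]) =
      ∑ p ∈ pairs n, stuffleCoeff a b c p.1 p.2 * mzv ![p.1, p.2]
      + (∑ l ∈ Finset.Ico 2 (n - 1), c ^ l * singleWeight a b (n - l)) * mzv ![n] := by
  have e0 : ∑ p ∈ stuffleTriples n, doubleWeight a b p.1 p.2.1 * c ^ p.2.2 *
        (mzv ![p.1, p.2.1, p.2.2] + mzv ![p.1, p.2.2, p.2.1] + mzv ![p.2.2, p.1, p.2.1]) =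
      ∑ p ∈ stuffleTriples n,
        doubleWeight a b p.1 p.2.1 * c ^ p.2.2 * (mzv ![p.1, p.2.1] * mzv ![p.2.2])
      - ∑ p ∈ stuffleTriples n,
        doubleWeight a b p.1 p.2.1 * c ^ p.2.2 * mzv ![p.1 + p.2.2, p.2.1]
      - ∑ p ∈ stuffleTriples n,
        doubleWeight a b p.1 p.2.1 * c ^ p.2.2 * mzv ![p.1, p.2.1 + p.2.2] := by
    rw [← Finset.sum_sub_distrib, ← Finset.sum_sub_distrib]
    refine Finset.sum_congr rfl fun p hp => ?_
    have := mem_stuffleTriples.1 hp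
    rw [mzv_two_mul_one this.1 this.2.1 this.2.2.1]
    ring
  rw [e0, sum_stuffleTriples n fun j k l => doubleWeight a b j k * c ^ l * (mzv ![j, k] * mzv ![l]),
    sum_stuffleTriples_fst n fun j k l => doubleWeight a b j k * c ^ l * mzv ![j + l, k],
    sum_stuffleTriples_snd n fun j k l => doubleWeight a b j k * c ^ l * mzv ![j, k + l]]
  have e1 : ∑ l ∈ Finset.Ico 2 (n - 1), ∑ p ∈ pairs (n - l),
        doubleWeight a b p.1 p.2 * c ^ l * (mzv ![p.1, p.2] * mzv ![l]) =
      ∑ l ∈ Finset.Ico 2 (n - 1), c ^ l * singleWeight a b (n - l) * mzv ![l, n - l]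
      + ∑ l ∈ Finset.Ico 2 (n - 1), c ^ (n - l) * singleWeight a b l * mzv ![l, n - l]
      + (∑ l ∈ Finset.Ico 2 (n - 1), c ^ l * singleWeight a b (n - l)) * mzv ![n] := by
    have r := Finset.sum_Ico_reflect
      (fun l => c ^ (n - l) * singleWeight a b l * mzv ![l, n - l]) 2 (show n - 1 ≤ n + 1 by omega)
    have r' : ∑ l ∈ Finset.Ico 2 (n - 1), c ^ (n - l) * singleWeight a b l * mzv ![l, n - l] =
        ∑ l ∈ Finset.Ico 2 (n - 1),
          c ^ (n - (n - l)) * singleWeight a b (n - l) * mzv ![n - l, n - (n - l)] := by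
      -- At `n = 0` truncated subtraction breaks the reflected bounds, but the sums are empty.
      rcases Nat.eq_zero_or_pos n with rfl | hn
      · simp
      · rw [r, show n + 1 - (n - 1) = 2 by omega, show n + 1 - 2 = n - 1 by omega]
    rw [r', Finset.sum_mul, ← Finset.sum_add_distrib, ← Finset.sum_add_distrib]
    refine Finset.sum_congr rfl fun l hl => ?_
    have := Finset.mem_Ico.1 hl
    have s := sum_doubleWeight a b (n - l)
    rw [← sum_pairs (n - l) fun j k => doubleWeight a b j k * mzv ![j, k]] at s
    have t := mzv_one_mul_one (show 2 ≤ l by omega) (show 2 ≤ n - l by omega)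
    rw [Nat.add_sub_cancel' (by omega)] at t
    rw [Nat.sub_sub_self (by omega)]
    have u : ∑ p ∈ pairs (n - l), doubleWeight a b p.1 p.2 * c ^ l * (mzv ![p.1, p.2] * mzv ![l]) =
        c ^ l * mzv ![l] * ∑ p ∈ pairs (n - l), doubleWeight a b p.1 p.2 * mzv ![p.1, p.2] := by
      rw [Finset.mul_sum]
      exact Finset.sum_congr rfl fun p _ => by ring
    rw [u, s]
    linear_combination c ^ l * singleWeight a b (n - l) * t
  rw [e1]
  have e2 : ∑ p ∈ pairs n, stuffleCoeff a b c p.1 p.2 * mzv ![p.1, p.2] =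
      ∑ p ∈ pairs n, (if 2 ≤ p.2 then (c ^ p.1 * singleWeight a b p.2
        + c ^ p.2 * singleWeight a b p.1) * mzv ![p.1, p.2] else 0)
      - ∑ p ∈ pairs n, ∑ l ∈ Finset.Ico 2 (p.1 - 1),
          doubleWeight a b (p.1 - l) p.2 * c ^ l * mzv ![p.1 - l + l, p.2]
      - ∑ p ∈ pairs n, ∑ l ∈ Finset.Ico 2 p.2,
          doubleWeight a b p.1 (p.2 - l) * c ^ l * mzv ![p.1, p.2 - l + l] := by
    rw [← Finset.sum_sub_distrib, ← Finset.sum_sub_distrib]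
    refine Finset.sum_congr rfl fun p _ => ?_
    rw [stuffleCoeff, sub_mul, sub_mul, Finset.sum_mul, Finset.sum_mul, ite_mul, zero_mul]
    congr 1
    · congr 1
      refine Finset.sum_congr rfl fun l hl => ?_
      have := Finset.mem_Ico.1 hl
      rw [Nat.sub_add_cancel (by omega)]
    · refine Finset.sum_congr rfl fun l hl => ?_
      have := Finset.mem_Ico.1 hl
      rw [Nat.sub_add_cancel (by omega)]
  rw [sum_pairs_of_two_le n fun j k =>
    (c ^ j * singleWeight a b k + c ^ k * singleWeight a b j) * mzv ![j, k]] at e2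
  simp only [add_mul, Finset.sum_add_distrib] at e2
  rw [e2]
  ring

/-- If `(j₀, k₀)` lies outside `pairs n`, the right side vanishes by the convention for
non-admissible indices; thus small `n` needs no separate treatment. -/
theorem sum_pairs_ite (n j₀ k₀ : ℕ) (hj : j₀ + k₀ = n) (x : ℝ) :
    ∑ p ∈ pairs n, (if p = (j₀, k₀) then x * mzv ![p.1, p.2] else 0) = x * mzv ![j₀, k₀] := by
  rw [Finset.sum_ite_eq']
  split_ifs with h
  · rfl
  · have : ¬ Admissible ![j₀, k₀] := by
      intro h'
      refine h (mem_pairs.2 ⟨(h' 0).2 rfl, (h' 1).1, hj⟩)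
    simp [mzv, this]

theorem sum_doublePoly {n : ℕ} (hn : 2 ≤ n) (a b c : ℝ) :
    ∑ p ∈ pairs n, doublePoly a b c p.1 p.2 * mzv ![p.1, p.2] =
      ∑ p ∈ pairs n, stuffleCoeff a b c p.1 p.2 * mzv ![p.1, p.2]
      + subleadingPoly n a b c * mzv ![n - 1, 1]
      - a * b * c ^ (n - 2) * mzv ![n - 2, 2]
      - cyc₃ (fun a b c => a ^ (n - 2) * b * c) a b c * mzv ![2, n - 2]
      + (if n = 3 then 1 else 0) * (a * b * c) * mzv ![2, 1] := by
  have h3 : (if n = 3 then 1 else 0) * (a * b * c) * mzv ![2, 1] =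
      ∑ p ∈ pairs n, (if n = 3 then a * b * c else 0) * mzv ![p.1, p.2] := by
    rcases eq_or_ne n 3 with rfl | h
    · have : pairs 3 = {(2, 1)} := by decide
      simp [this]
    · simp [h]
  rw [h3, ← sum_pairs_ite n (n - 1) 1 (by omega), ← sum_pairs_ite n (n - 2) 2 (by omega),
    ← sum_pairs_ite n 2 (n - 2) (by omega), ← Finset.sum_add_distrib, ← Finset.sum_sub_distrib,
    ← Finset.sum_sub_distrib, ← Finset.sum_add_distrib]
  refine Finset.sum_congr rfl fun ⟨j, k⟩ hp => ?_
  obtain ⟨hj, hk, hjk⟩ := mem_pairs.1 hp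
  simp only at hj hk hjk
  have i1 : (j, k) = (n - 1, 1) ↔ k = 1 := by rw [Prod.mk.injEq]; omega
  have i2 : (j, k) = (n - 2, 2) ↔ k = 2 := by rw [Prod.mk.injEq]; omega
  have i3 : (j, k) = (2, n - 2) ↔ j = 2 := by rw [Prod.mk.injEq]; omega
  simp only [i1, i2, i3, doublePoly, hjk, add_mul, sub_mul, ite_mul, zero_mul]

end WeightedSum

end

open WeightedSum in
theorem mainTheorem8 (n : ℕ) (hn : 2 ≤ n) (a b c : ℝ) :
    -- the values at `(a, b, c)` of the three coefficients that are written as quotients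
    ∃ (D : ℕ → ℕ → ℝ) (S Z : ℝ),
      -- away from the zeros of the denominators they are the displayed quotients
      ((a, b, c) ∈ generic →
        (∀ j k : ℕ, 2 ≤ j → 1 ≤ k → j + k = n → D j k = doubleCoeff a b c j k) ∧
        S = subleadingCoeff n a b c ∧ Z = singleCoeff n a b c) ∧
      -- at every point they are the limits of the displayed quotients
      (∀ j k : ℕ, 2 ≤ j → 1 ≤ k → j + k = n →
        Tendsto (fun p : ℝ × ℝ × ℝ => doubleCoeff p.1 p.2.1 p.2.2 j k)
          (𝓝[generic] (a, b, c)) (𝓝 (D j k))) ∧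
      Tendsto (fun p : ℝ × ℝ × ℝ => subleadingCoeff n p.1 p.2.1 p.2.2)
        (𝓝[generic] (a, b, c)) (𝓝 S) ∧
      Tendsto (fun p : ℝ × ℝ × ℝ => singleCoeff n p.1 p.2.1 p.2.2)
        (𝓝[generic] (a, b, c)) (𝓝 Z) ∧
      -- the identity
      (∑ p ∈ triples n,
          (fun j k l : ℕ =>
            cyc₂ (fun a b =>
              a * (a + b) ^ (j - 1) * (b ^ k * c ^ l + b ^ l * c ^ k)
                + a * (a + b) ^ (k - 1) * b ^ l * c ^ j
                - cyc₃ (fun j k l => a ^ (j + k - 1) * b * c ^ l + a ^ j * b ^ k * c ^ l) j k l)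
              a b * mzv ![j, k, l]) p.1 p.2.1 p.2.2
        - ∑ p ∈ pairs (n - 1),
            (fun j k : ℕ =>
              cyc₂ (fun a b =>
                a * (a + b) ^ (j - 1) * b ^ k * c - a ^ (j + k - 1) * b * c - a ^ j * b ^ k * c)
                a b * mzv ![j, k, 1]) p.1 p.2
        - ∑ p ∈ pairs (n - 1),
            (fun j k : ℕ =>
              cyc₂ (fun a b =>
                a * (a + b) ^ (j - 1) * b ^ k * c - a ^ (j + k - 1) * b * c
                  - a ^ k * b * c ^ j - a ^ k * c * b ^ j)
                a b * mzv ![j, 1, k]) p.1 p.2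
        = ∑ p ∈ pairs n, D p.1 p.2 * mzv ![p.1, p.2]
          - S * mzv ![n - 1, 1]
          + Z * mzv ![n]
          + b * c * a ^ (n - 2) * mzv ![n]
          + a * b * c ^ (n - 2) * mzv ![n - 2, 2]
          + cyc₃ (fun a b c => a ^ (n - 2) * b * c) a b c * mzv ![2, n - 2]
          - (if n = 2 then 1 else 0) * (a * b + a * c + b * c) * mzv ![2]
          - (if n = 3 then 1 else 0) * (a * b * c) * (mzv ![2, 1] + mzv ![3])) := by
  -- A continuous function that agrees with the quotient on `generic` gives its limit at every
  -- point, including those with vanishing denominators.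
  have lim : ∀ {f g : ℝ × ℝ × ℝ → ℝ}, Continuous f → (∀ p ∈ generic, f p = g p) →
      Tendsto g (𝓝[generic] (a, b, c)) (𝓝 (f (a, b, c))) := fun hf h =>
    (hf.continuousAt.tendsto.mono_left nhdsWithin_le_nhds).congr'
      (eventually_nhdsWithin_of_forall h)
  refine ⟨doublePoly a b c, subleadingPoly n a b c, singlePoly n a b c,
    fun h => ⟨fun j k hj hk _ => doublePoly_eq hj hk h, subleadingPoly_eq hn h,
      singlePoly_eq hn h⟩,
    fun j k hj hk _ => lim (continuous_doublePoly j k) fun p hp => doublePoly_eq hj hk hp,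
    lim (continuous_subleadingPoly n) fun p hp => subleadingPoly_eq hn hp,
    lim (continuous_singlePoly n) fun p hp => singlePoly_eq hn hp, ?_⟩
  rw [triple_sum_eq, stuffle_triple_sum, sum_doublePoly hn, singlePoly]
  rcases eq_or_ne n 2 with rfl | h2
  · norm_num
    ring
  rcases eq_or_ne n 3 with rfl | h3
  · norm_num
    ring
  · rw [if_neg h2, if_neg h3]
    ring
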